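/- Let $F_1\in\mathbb{C}^{n\times n}$ and $F_2\in\mathbb{C}^{n\times n^2}$ (in particular real matrices), and let $F_1=W\Lambda W^{-1}$ with $W$ invertible and $\Lambda=\mathrm{diag}(\lambda_1,\dots,\lambda_n)$. For $N\ge 0$ let $\mathbf{A}$ be the truncated Carleman matrix of $\dot x=F_1x+F_2\,x\otimes x$: the block matrix with blocks indexed by $1\le j\le N$ (the $j$-th of size $n^j$), diagonal blocks $A_{j,j}=\sum_{i=0}^{j-1}I^{\otimes i}\otimes F_1\otimes I^{\otimes(j-1-i)}$, superdiagonal blocks $A_{j,j+1}=\sum_{i=0}^{j-1}I^{\otimes i}\otimes F_2\otimes I^{\otimes(j-1-i)}$, and all other blocks zero. Let $\|\cdot\|_1$ be the matrix norm induced by the $\ell^1$ vector norm, $\kappa_1(W)=\|W\|_1\|W^{-1}\|_1$, and let $\widehat W$ be $W$ with its columns scaled to unit $\ell^1$ norm (so $\widehat W=W$ if the eigenvectors are normalized). Assume the no-resonance condition: $\lambda_i\neq\sum_{j}m_j\lambda_j$ for all $i$ and all integers $m_j\ge0$ with $\sum_j m_j\ge2$. Put $$\Delta=\inf_{k}\ \inf_{m_j\ge0,\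 \sum_j m_j\ge2}\Big|\lambda_k-\sum_{j}m_j\lambda_j\Big| .$$ Let $D$ be the block diagonal matrix whose $j$-th block is the Kronecker sum $\sum_{i=0}^{j-1}I^{\otimes i}\otimes\Lambda\otimes I^{\otimes(j-1-i)}$. Then $D$ is diagonal and $\mathbf{A}$ is diagonalizable: there is an invertible matrix $V$ with $\mathbf{A}V=VD$, and $V$ is block upper triangular with diagonal blocks $V_{k,k}=\widehat W^{\otimes k}$. Moreover, in the eigenbasis of $F_1$ the diagonal blocks are identities: $V=\mathrm{diag}(\widehat W,\widehat W^{\otimes2},\dots,\widehat W^{\otimes N})\,V^{0}$, where $V^{0}$ is block upper triangular, $V^{0}_{k,k}=I$ for all $k$, and $\mathbf{A}^{0}V^{0}=V^{0}D$ for the truncated Carleman matrix $\mathbf{A}^{0}$ of the transformed coefficients $\Lambda$ and $\widehat W^{-1}F_2(\widehat W\otimes\widehat W)$. If $\Delta>0$, then for $M=V$ and for $M=V^{0}$, and all $1\le k\le j\le N$, $$\|M_{k,j}\|_1\le\Big(\frac{\kappa_1(W)\|F_2\|_1}{\Delta}\Big)^{j-k}\binom{2j-k}{j-k};$$ consequently,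 for $k<j$, $$\|M_{k,j}\|_1\le\Big(e\,\frac{2j-k}{j-k}\cdot\frac{\kappa_1(W)\|F_2\|_1}{\Delta}\Big)^{j-k};$$ and for $k\le 5$ and $k\le j$, $$\|M_{k,j}\|_1\le\Big(\frac{2e\,\kappa_1(W)\|F_2\|_1}{\Delta}\Big)^{j-k}.$$ -/

import Mathlib

open scoped Kronecker

namespace Carleman

/-! Tensors of order `j` on an `n`-dimensional space are indexed by tuples `Fin j → Fin n`. -/

/-- The `k`-fold Kronecker power `M ⊗ ⋯ ⊗ M`. -/
def kronPow {R : Type*} [CommRing R] {n : ℕ} (M : Matrix (Fin n) (Fin n) R) (k : ℕ) :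
    Matrix (Fin k → Fin n) (Fin k → Fin n) R :=
  Matrix.of fun a b => ∏ l, M (a l) (b l)

/-- The Kronecker sum `∑ i, I ^ ⊗ i ⊗ M ⊗ I ^ ⊗ (j - 1 - i)`, where `i` runs over `0, …, j - 1`. -/
def kronSum {R : Type*} [CommRing R] {n : ℕ} (M : Matrix (Fin n) (Fin n) R) (j : ℕ) :
    Matrix (Fin j → Fin n) (Fin j → Fin n) R :=
  Matrix.of fun a b => ∑ i : Fin j,
    (∏ l with l < i, (1 : Matrix (Fin n) (Fin n) R) (a l) (b l)) * M (a i) (b i) *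
      ∏ l with i < l, (1 : Matrix (Fin n) (Fin n) R) (a l) (b l)

/-- The matrix `∑ i, I ^ ⊗ i ⊗ F ⊗ I ^ ⊗ (j - 1 - i)`, where `i` runs over `0, …, j - 1` and `F`
sends tensors of order two to vectors. -/
def kronShift {R : Type*} [CommRing R] {n : ℕ} (F : Matrix (Fin n) (Fin n × Fin n) R) (j : ℕ) :
    Matrix (Fin j → Fin n) (Fin (j + 1) → Fin n) R :=
  Matrix.of fun a b => ∑ i : Fin j,
    (∏ l with l < i, (1 : Matrix (Fin n) (Fin n) R) (a l) (b l.castSucc)) *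
      F (a i) (b i.castSucc, b i.succ) *
      ∏ l with i < l, (1 : Matrix (Fin n) (Fin n) R) (a l) (b l.succ)

/-- Index set of the truncated system at level `N`: the block `k : Fin N` holds the tensors of
order `k + 1`. -/
abbrev Index (n N : ℕ) : Type := Σ k : Fin N, (Fin (k.val + 1) → Fin n)

/-- The truncated Carleman matrix: block bidiagonal, with `kronSum F₁ j` on the diagonal and
`kronShift F₂ j` next to it. -/
def carleman {R : Type*} [CommRing R] {n : ℕ} (F₁ : Matrix (Fin n) (Fin n) R)
    (F₂ : Matrix (Fin n) (Fin n × Fin n) R) (N : ℕ) : Matrix (Index n N) (Index n N) R :=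
  Matrix.of fun p q =>
    if h : p.1.val + 1 = q.1.val + 1 then
      kronSum F₁ (p.1.val + 1) p.2 (q.2 ∘ Fin.cast h)
    else if h : p.1.val + 1 + 1 = q.1.val + 1 then
      kronShift F₂ (p.1.val + 1) p.2 (q.2 ∘ Fin.cast h)
    else 0

/-- The block diagonal matrix of the Kronecker sums of `Λ = diag lam`. -/
def eigenvalueMatrix {R : Type*} [CommRing R] {n : ℕ} (lam : Fin n → R) (N : ℕ) :
    Matrix (Index n N) (Index n N) R :=
  Matrix.blockDiagonal' fun k : Fin N => kronSum (Matrix.diagonal lam) (k.val + 1)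

/-- The block diagonal matrix of the Kronecker powers of `M`. -/
def blockPow {R : Type*} [CommRing R] {n : ℕ} (M : Matrix (Fin n) (Fin n) R) (N : ℕ) :
    Matrix (Index n N) (Index n N) R :=
  Matrix.blockDiagonal' fun k : Fin N => kronPow M (k.val + 1)

/-- The block in block row `k` and block column `j`. -/
def block {R : Type*} {n N : ℕ} (V : Matrix (Index n N) (Index n N) R) (k j : Fin N) :
    Matrix (Fin (k.val + 1) → Fin n) (Fin (j.val + 1) → Fin n) R :=
  Matrix.of fun a b => V ⟨k, a⟩ ⟨j, b⟩

/-- The matrix norm induced by the `ℓ¹` vector norms. -/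
noncomputable def oneNorm {ι κ : Type*} [Fintype ι] [Fintype κ] [DecidableEq κ]
    (M : Matrix ι κ ℂ) : ℝ :=
  ‖(Matrix.toLpLin 1 1 M).toContinuousLinearMap‖

/-- The condition number in the `ℓ¹` norm. -/
noncomputable def cond {n : ℕ} (W : Matrix (Fin n) (Fin n) ℂ) : ℝ :=
  oneNorm W * oneNorm W⁻¹

/-- The matrix `W` with its columns scaled to unit `ℓ¹` norm. -/
noncomputable def normalizeColumns {n : ℕ} (W : Matrix (Fin n) (Fin n) ℂ) :
    Matrix (Fin n) (Fin n) ℂ :=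
  Matrix.of fun i j => W i j / ((∑ l, ‖W l j‖ : ℝ) : ℂ)

/-- No eigenvalue is a combination of the eigenvalues with nonnegative integer coefficients whose
sum is at least two. -/
def NoResonance {n : ℕ} (lam : Fin n → ℂ) : Prop :=
  ∀ (i : Fin n) (m : Fin n → ℕ), 2 ≤ ∑ j, m j → lam i ≠ ∑ j, (m j : ℂ) * lam j

/-- The resonance parameter `Δ`. -/
noncomputable def resonanceParam {n : ℕ} (lam : Fin n → ℂ) : ℝ :=
  ⨅ k : Fin n, ⨅ m : {m : Fin n → ℕ // 2 ≤ ∑ j, m j}, ‖lam k - ∑ j, (m.1 j : ℂ) * lam j‖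

end Carleman

/-! A formal change of variables `x = u(y)`, tangent to the identity, turns `x' = Λ x + F (x ⊗ x)`
into `y' = Λ y` (Poincaré linearization). Carried out in noncommutative variables, where the
coefficients of `u` are indexed by words, the tensor powers of `x` are linear in those of `y`,
`x ^ ⊗ k = ∑ j, V₀ k j (y ^ ⊗ j)`, and comparing derivatives says that the columns of `V₀` are
eigenvectors of the Carleman matrix of `Λ` and `F`. The denominators that occur in `u` are sums of
at least two eigenvalues minus a single one, so that the absence of resonances suffices although
the Carleman matrix may well have multiple eigenvalues.

The column sums of the coefficients of `u` satisfy a quadratic recursion majorized by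
`y = X + r * y ^ 2` with `r = ‖F‖ / Δ`. Its solution is `X * C(r * X)` for the Catalan series `C`,
so that the coefficients of its powers are ballot numbers times powers of `r`. For
`F = Ŵ⁻¹ F₂ (Ŵ ⊗ Ŵ)`, the similarity by the Kronecker powers of `Ŵ`, which have norm at most one,
carries everything over to `V`. -/

namespace Carleman

section Ballot

open PowerSeries

/-- The ballot numbers, equal to `k / (2 * m + k) * (2 * m + k).choose m` unless `k = m = 0`, as
coefficients of the powers of the generating function of the Catalan numbers. -/
noncomputable def ballot (k m : ℕ) : ℕ :=
  coeff m (catalanSeries ^ k)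

@[simp] theorem ballot_zero_right (k : ℕ) : ballot k 0 = 1 := by
  simp [ballot]

@[simp] theorem ballot_zero_succ (m : ℕ) : ballot 0 (m + 1) = 0 := by
  simp [ballot, coeff_one]

theorem ballot_succ_succ (k m : ℕ) :
    ballot (k + 1) (m + 1) = ballot k (m + 1) + ballot (k + 2) m := by
  have hpow : catalanSeries ^ (k + 1) = catalanSeries ^ k + catalanSeries ^ (k + 2) * X := by
    calc catalanSeries ^ (k + 1) = catalanSeries ^ k * (catalanSeries ^ 2 * X + 1) := by
          rw [catalanSeries_sq_mul_X_add_one, pow_succ]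
      _ = catalanSeries ^ k + catalanSeries ^ (k + 2) * X := by ring
  rw [ballot, hpow, map_add, coeff_succ_mul_X, ballot, ballot]

theorem ballot_mono_left (m : ℕ) : Monotone fun k => ballot k m := by
  refine monotone_nat_of_le_succ fun k => ?_
  cases m with
  | zero => simp
  | succ m => simp [ballot_succ_succ]

theorem two_mul_add_mul_ballot (k m : ℕ) :
    (2 * m + k) * ballot k m = k * (2 * m + k).choose m := by
  induction m generalizing k with
  | zero => simp
  | succ m ihm =>
    induction k with
    | zero => simp
    | succ k ihk =>
      have hk := ihm (k + 2)
      have hratio := Nat.choose_succ_right_eq (2 * m + k + 2) m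
      rw [show 2 * m + k + 2 - m = m + k + 2 by lia] at hratio
      rw [show 2 * (m + 1) + k = 2 * m + k + 2 by ring] at ihk
      rw [show 2 * m + (k + 2) = 2 * m + k + 2 by ring] at hk
      refine Nat.eq_of_mul_eq_mul_left (show 0 < 2 * m + k + 2 by lia) ?_
      rw [ballot_succ_succ, show 2 * (m + 1) + (k + 1) = 2 * m + k + 2 + 1 by ring,
        Nat.choose_succ_succ]
      linear_combination (2 * m + k + 3) * (ihk + hk) - 2 * hratio

theorem ballot_le_choose (k m : ℕ) : ballot k m ≤ (2 * m + k).choose m := by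
  rcases Nat.eq_zero_or_pos (2 * m + k) with h | h
  · obtain ⟨rfl, rfl⟩ : m = 0 ∧ k = 0 := by lia
    simp
  · refine Nat.le_of_mul_le_mul_left ?_ h
    rw [two_mul_add_mul_ballot]
    exact Nat.mul_le_mul_right _ (by lia)

theorem ballot_five_succ (m : ℕ) :
    (m + 1) * (m + 6) * ballot 5 (m + 1) = (2 * m + 6) * (2 * m + 5) * ballot 5 m := by
  have hm := two_mul_add_mul_ballot 5 m
  have hsucc := two_mul_add_mul_ballot 5 (m + 1)
  have htop := Nat.choose_mul_succ_eq (2 * m + 5) m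
  have hboth := Nat.add_one_mul_choose_eq (2 * m + 6) m
  rw [show 2 * m + 5 + 1 - m = m + 6 by lia] at htop
  refine Nat.eq_of_mul_eq_mul_left (show 0 < 2 * m + 7 by lia) ?_
  simp only [show 2 * (m + 1) + 5 = 2 * m + 7 by ring] at hsucc
  linear_combination (m + 1) * (m + 6) * hsucc - 5 * (m + 6) * hboth
    - (2 * m + 7) * 5 * htop - (2 * m + 7) * (2 * m + 6) * hm

theorem ballot_five_le (m : ℕ) : ballot 5 m ≤ 5 ^ m := by
  induction m with
  | zero => simp
  | succ m ih =>
    refine Nat.le_of_mul_le_mul_left ?_ (show 0 < (m + 1) * (m + 6) by positivity)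
    calc (m + 1) * (m + 6) * ballot 5 (m + 1)
        = (2 * m + 6) * (2 * m + 5) * ballot 5 m := ballot_five_succ m
      _ ≤ 5 * ((m + 1) * (m + 6)) * 5 ^ m := Nat.mul_le_mul (by nlinarith) ih
      _ = (m + 1) * (m + 6) * 5 ^ (m + 1) := by ring

theorem choose_le_exp_mul_div_pow (p : ℕ) {m : ℕ} (hm : m ≠ 0) :
    (p.choose m : ℝ) ≤ (Real.exp 1 * (p / m)) ^ m := by
  calc (p.choose m : ℝ) ≤ (p : ℝ) ^ m / m.factorial := Nat.choose_le_pow_div m p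
    _ = (m : ℝ) ^ m / m.factorial * (p / m : ℝ) ^ m := by
        rw [div_pow]
        field_simp
    _ ≤ Real.exp m * (p / m : ℝ) ^ m := by
        gcongr
        exact Real.pow_div_factorial_le_exp _ (Nat.cast_nonneg m) m
    _ = (Real.exp 1 * (p / m)) ^ m := by rw [mul_pow, ← Real.exp_nat_mul, mul_one]

theorem ballot_le_two_mul_exp_pow {k : ℕ} (hk : k ≤ 5) (m : ℕ) :
    (ballot k m : ℝ) ≤ (2 * Real.exp 1) ^ m := by
  calc (ballot k m : ℝ) ≤ 5 ^ m := mod_cast (ballot_mono_left m hk).trans (ballot_five_le m)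
    _ ≤ (2 * Real.exp 1) ^ m := by
        gcongr
        linarith [Real.exp_one_gt_d9]

end Ballot

section CatalanMajorant

open PowerSeries

variable {R : Type*} [CommRing R]

/-- The power series `X * C(r * X)`, where `C` is the generating function of the Catalan numbers. It
is the solution of `y = X + r * y ^ 2` without constant term, and majorizes the solution of a
quadratic recursion whose ratio is bounded by `r`. -/
noncomputable def catalanMajorant (r : R) : R⟦X⟧ :=
  X * rescale r (map (Nat.castRingHom R) catalanSeries)

theorem catalanMajorant_eq (r : R) :
    catalanMajorant r = X + C r * catalanMajorant r ^ 2 := by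
  have h := congrArg (fun p => rescale r (map (Nat.castRingHom R) p)) catalanSeries_sq_mul_X_add_one
  simp only [map_add, map_mul, map_pow, map_one, map_X, rescale_X] at h
  rw [catalanMajorant]
  linear_combination -X * h

@[simp] theorem coeff_zero_catalanMajorant (r : R) : coeff 0 (catalanMajorant r) = 0 := by
  simp [catalanMajorant]

@[simp] theorem coeff_one_catalanMajorant (r : R) : coeff 1 (catalanMajorant r) = 1 := by
  rw [catalanMajorant, ← zero_add 1, coeff_succ_X_mul]
  simp

theorem coeff_catalanMajorant_of_two_le (r : R) {m : ℕ} (hm : 2 ≤ m) :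
    coeff m (catalanMajorant r) = r * coeff m (catalanMajorant r * catalanMajorant r) := by
  conv_lhs => rw [catalanMajorant_eq, map_add, coeff_C_mul, coeff_X, if_neg (by lia), zero_add, sq]

theorem coeff_add_catalanMajorant_pow (r : R) (k m : ℕ) :
    coeff (k + m) (catalanMajorant r ^ k) = r ^ m * ballot k m := by
  rw [catalanMajorant, mul_pow, add_comm, coeff_X_pow_mul, ← map_pow, coeff_rescale, ← map_pow,
    coeff_map, ballot, eq_natCast]

theorem coeff_catalanMajorant_nonneg {r : ℝ} (hr : 0 ≤ r) (m : ℕ) :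
    0 ≤ coeff m (catalanMajorant r) := by
  cases m with
  | zero => simp
  | succ m =>
    rw [catalanMajorant, coeff_succ_X_mul, coeff_rescale, coeff_map]
    simp only [eq_natCast]
    positivity

end CatalanMajorant

section WordSeries

variable {R ι κ : Type*} [CommSemiring R]

/-- The product of two noncommutative power series, given by their coefficients at words: the sum
over all ways to cut the word in two. -/
def wordConv : (List ι → R) →ₗ[R] (List ι → R) →ₗ[R] List ι → R :=
  LinearMap.mk₂ R (fun f g b => ∑ i ∈ Finset.range (b.length + 1), f (b.take i) * g (b.drop i))
    (fun _ _ _ => by ext; simp [add_mul, Finset.sum_add_distrib])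
    (fun _ _ _ => by ext; simp [mul_assoc, Finset.mul_sum])
    (fun _ _ _ => by ext; simp [mul_add, Finset.sum_add_distrib])
    (fun _ _ _ => by ext; simp [mul_left_comm, Finset.mul_sum])

theorem wordConv_apply (f g : List ι → R) (b : List ι) :
    wordConv f g b = ∑ i ∈ Finset.range (b.length + 1), f (b.take i) * g (b.drop i) := rfl

@[simp] theorem wordConv_nil (f g : List ι → R) : wordConv f g [] = f [] * g [] := by
  simp [wordConv_apply]

theorem wordConv_cons (f g : List ι → R) (x : ι) (b : List ι) :
    wordConv f g (x :: b) = f [] * g (x :: b) + wordConv (fun l => f (x :: l)) g b := by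
  rw [wordConv_apply, List.length_cons, Finset.sum_range_succ', add_comm]
  rfl

theorem wordConv_assoc (f g h : List ι → R) :
    wordConv (wordConv f g) h = wordConv f (wordConv g h) := by
  ext b
  induction b generalizing f with
  | nil => simp only [wordConv_nil, mul_assoc]
  | cons x b ih =>
    have hcut : (fun l => wordConv f g (x :: l)) =
        f [] • (fun l => g (x :: l)) + wordConv (fun l => f (x :: l)) g := by
      ext l
      exact wordConv_cons f g x l
    rw [wordConv_cons, hcut, map_add, map_smul, LinearMap.add_apply, LinearMap.smul_apply,
      Pi.add_apply, Pi.smul_apply, ih, wordConv_nil, wordConv_cons f, wordConv_cons g, smul_eq_mul]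
    ring

/-- The additive weight of a word. For `lam` the eigenvalues of a diagonal matrix, the weights of
the words of length `j` are the eigenvalues of its `j`-th Kronecker sum. -/
def wordWeight (lam : ι → R) (b : List ι) : R :=
  (b.map lam).sum

@[simp] theorem wordWeight_nil (lam : ι → R) : wordWeight lam [] = 0 := rfl

@[simp] theorem wordWeight_cons (lam : ι → R) (x : ι) (b : List ι) :
    wordWeight lam (x :: b) = lam x + wordWeight lam b := by
  simp [wordWeight]

theorem wordWeight_append (lam : ι → R) (b c : List ι) :
    wordWeight lam (b ++ c) = wordWeight lam b + wordWeight lam c := by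
  simp [wordWeight]

theorem wordWeight_eq_sum_count [Fintype ι] [DecidableEq ι] (lam : ι → R) (b : List ι) :
    wordWeight lam b = ∑ j, (b.count j : R) * lam j := by
  simp only [wordWeight, Finset.sum_list_map_count, nsmul_eq_mul]
  refine Finset.sum_subset (Finset.subset_univ _) fun j _ hj => ?_
  rw [List.count_eq_zero_of_not_mem (by simpa using hj), Nat.cast_zero, zero_mul]

theorem wordWeight_mul_wordConv (lam : ι → R) (f g : List ι → R) :
    wordWeight lam * wordConv f g =
      wordConv (wordWeight lam * f) g + wordConv f (wordWeight lam * g) := by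
  ext b
  simp only [Pi.mul_apply, Pi.add_apply, wordConv_apply, Finset.mul_sum, ← Finset.sum_add_distrib]
  refine Finset.sum_congr rfl fun i _ => ?_
  nth_rw 1 [← List.take_append_drop i b, wordWeight_append]
  ring

/-- The derivation that replaces one letter `a` of a word by the combination `∑ c, F a c` of
two-letter words, applied to a function of words. On words of length `j` it is `kronShift F j`. -/
def shiftAct {M : Type*} [AddCommMonoid M] [Module R M] [Fintype κ] (F : Matrix κ (κ × κ) R) :
    (List κ → M) → List κ → M
  | _, [] => 0
  | G, a :: l => (∑ c, F a c • G (c.1 :: c.2 :: l)) + shiftAct F (fun t => G (a :: t)) l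

theorem shiftAct_map {M M' : Type*} [AddCommMonoid M] [Module R M] [AddCommMonoid M'] [Module R M']
    [Fintype κ] (F : Matrix κ (κ × κ) R) (φ : M →ₗ[R] M') (G : List κ → M) (l : List κ) :
    shiftAct F (fun t => φ (G t)) l = φ (shiftAct F G l) := by
  induction l generalizing G with
  | nil => simp only [shiftAct, map_zero]
  | cons a l ih => simp only [shiftAct, map_add, map_sum, map_smul, ih]

variable [DecidableEq ι]

/-- The product of the series `v a` along a word of indices `a`. -/
def wordProd (v : κ → List ι → R) : List κ → List ι → R
  | [] => Pi.single [] 1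
  | a :: l => wordConv (v a) (wordProd v l)

theorem wordProd_nil_apply (v : κ → List ι → R) (b : List ι) :
    wordProd v [] b = if b = [] then 1 else 0 :=
  Pi.single_apply _ _ _

theorem wordProd_cons_cons {v : κ → List ι → R} {a : κ} (ha : v a [] = 0) (l : List κ) (x : ι)
    (b : List ι) :
    wordProd v (a :: l) (x :: b) = wordConv (fun t => v a (x :: t)) (wordProd v l) b := by
  rw [wordProd, wordConv_cons, ha, zero_mul, zero_add]

theorem wordProd_of_length_lt {v : κ → List ι → R} (hv : ∀ a, v a [] = 0) {l : List κ}
    {b : List ι} (h : b.length < l.length) : wordProd v l b = 0 := by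
  induction l generalizing b with
  | nil => simp at h
  | cons a l ih =>
    cases b with
    | nil => simp [wordProd, hv]
    | cons x b =>
      rw [wordProd_cons_cons (hv a), wordConv_apply]
      refine Finset.sum_eq_zero fun i _ => ?_
      rw [ih, mul_zero]
      simp only [List.length_cons, List.length_drop] at h ⊢
      lia

theorem wordProd_of_length_eq {v : ι → List ι → R} (hv : ∀ a, v a [] = 0)
    (hv' : ∀ a x, v a [x] = if a = x then 1 else 0) {l b : List ι} (h : b.length = l.length) :
    wordProd v l b = if l = b then 1 else 0 := by
  induction l generalizing b with
  | nil => simp [wordProd_nil_apply, eq_comm]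
  | cons a l ih =>
    cases b with
    | nil => simp at h
    | cons x b =>
      have hb : b.length = l.length := by simpa using h
      rw [wordProd_cons_cons (hv a), wordConv_apply, Finset.sum_eq_single 0]
      · simp only [List.take_zero, List.drop_zero, hv', ih hb, List.cons.injEq, ite_and, ite_mul,
          one_mul, zero_mul]
      · intro i hi hi0
        rw [Finset.mem_range] at hi
        rw [wordProd_of_length_lt hv, mul_zero]
        rw [List.length_drop]
        lia
      · simp

theorem wordWeight_mul_wordProd [Fintype κ] {lam : ι → R} {mu : κ → R} {F : Matrix κ (κ × κ) R}
    {v : κ → List ι → R}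
    (hv : ∀ a, wordWeight lam * v a =
      mu a • v a + ∑ c : κ × κ, F a c • wordConv (v c.1) (v c.2)) (l : List κ) :
    wordWeight lam * wordProd v l =
      wordWeight mu l • wordProd v l + shiftAct F (wordProd v) l := by
  induction l with
  | nil =>
    ext b
    by_cases hb : b = [] <;> simp [wordProd_nil_apply, shiftAct, hb]
  | cons a l ih =>
    simp only [wordProd, wordWeight_mul_wordConv, hv, ih, shiftAct, wordWeight_cons,
      shiftAct_map F (wordConv (v a)) (wordProd v), map_add, map_sum, map_smul, LinearMap.add_apply,
      LinearMap.sum_apply, LinearMap.smul_apply, wordConv_assoc, add_smul]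
    abel

end WordSeries

section LinearizingSeries

variable {K ι : Type*} [Field K] [Fintype ι] [DecidableEq ι]

/-- The coefficient at a word of the `a`-th component of the formal change of variables `x = u(y)`,
tangent to the identity, that turns `x' = Λ x + F (x ⊗ x)` into the linear system `y' = Λ y`, where
`Λ = diag lam`. -/
def linearizingSeries (lam : ι → K) (F : Matrix ι (ι × ι) K) : ι → List ι → K
  | _, [] => 0
  | a, [x] => if a = x then 1 else 0
  | a, x :: y :: t =>
    (∑ c : ι × ι, F a c * ∑ i : Fin (t.length + 1),
      linearizingSeries lam F c.1 (x :: (y :: t).take i) *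
        linearizingSeries lam F c.2 ((y :: t).drop i)) /
      (wordWeight lam (x :: y :: t) - lam a)
termination_by _ b => b.length
decreasing_by
  · simp only [List.length_cons, List.length_take]
    lia
  · simp only [List.length_cons, List.length_drop]
    lia

variable (lam : ι → K) (F : Matrix ι (ι × ι) K)

@[simp] theorem linearizingSeries_nil (a : ι) : linearizingSeries lam F a [] = 0 := by
  rw [linearizingSeries]

theorem linearizingSeries_singleton (a x : ι) :
    linearizingSeries lam F a [x] = if a = x then 1 else 0 := by
  rw [linearizingSeries]

theorem linearizingSeries_of_two_le (a : ι) {b : List ι} (hb : 2 ≤ b.length) :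
    linearizingSeries lam F a b =
      (∑ c : ι × ι, F a c *
        wordConv (linearizingSeries lam F c.1) (linearizingSeries lam F c.2) b) /
        (wordWeight lam b - lam a) := by
  match b, hb with
  | x :: y :: t, _ =>
    rw [linearizingSeries]
    congr 1
    refine Finset.sum_congr rfl fun c _ => ?_
    rw [wordConv_cons, linearizingSeries_nil, zero_mul, zero_add, wordConv_apply,
      Finset.sum_range_succ, List.drop_length, linearizingSeries_nil, mul_zero, add_zero,
      List.length_cons, Finset.sum_range]

theorem wordConv_linearizingSeries_of_length_lt_two (a c : ι) {b : List ι} (hb : b.length < 2) :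
    wordConv (linearizingSeries lam F a) (linearizingSeries lam F c) b = 0 := by
  match b, hb with
  | [], _ => simp
  | [x], _ => simp [wordConv_cons]

variable {lam}

theorem wordWeight_mul_linearizingSeries
    (hlam : ∀ a (b : List ι), 2 ≤ b.length → wordWeight lam b ≠ lam a) (a : ι) :
    wordWeight lam * linearizingSeries lam F a =
      lam a • linearizingSeries lam F a +
        ∑ c : ι × ι,
          F a c • wordConv (linearizingSeries lam F c.1) (linearizingSeries lam F c.2) := by
  ext b
  simp only [Pi.mul_apply, Pi.add_apply, Pi.smul_apply, Finset.sum_apply, smul_eq_mul]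
  rcases le_or_gt 2 b.length with hb | hb
  · have hsolve := linearizingSeries_of_two_le lam F a hb
    rw [eq_div_iff (sub_ne_zero.2 (hlam a b hb))] at hsolve
    linear_combination hsolve
  · simp only [wordConv_linearizingSeries_of_length_lt_two lam F _ _ hb, mul_zero,
      Finset.sum_const_zero, add_zero]
    match b, hb with
    | [], _ => simp
    | [x], _ =>
      rw [linearizingSeries_singleton]
      by_cases h : a = x <;> simp [h]

end LinearizingSeries

section Majorant

open PowerSeries

variable {R ι κ μ : Type*} [Fintype κ] [Fintype μ]

theorem sum_norm_wordConv_le [NormedCommRing R] {f : κ → List ι → R} {g : μ → List ι → R}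
    {p q : ℝ⟦X⟧} {b : List ι}
    (h : ∀ c d, c ++ d = b →
      (∑ x, ‖f x c‖) * (∑ y, ‖g y d‖) ≤ coeff c.length p * coeff d.length q) :
    ∑ x : κ × μ, ‖wordConv (f x.1) (g x.2) b‖ ≤ coeff b.length (p * q) := by
  rw [coeff_mul, Finset.Nat.sum_antidiagonal_eq_sum_range_succ fun i j => coeff i p * coeff j q]
  calc ∑ x : κ × μ, ‖wordConv (f x.1) (g x.2) b‖
      ≤ ∑ x : κ × μ, ∑ i ∈ Finset.range (b.length + 1),
          ‖f x.1 (b.take i)‖ * ‖g x.2 (b.drop i)‖ :=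
        Finset.sum_le_sum fun x _ => by
          rw [wordConv_apply]
          exact norm_sum_le_of_le _ fun i _ => norm_mul_le _ _
    _ = ∑ i ∈ Finset.range (b.length + 1),
          (∑ x, ‖f x (b.take i)‖) * (∑ y, ‖g y (b.drop i)‖) := by
        rw [Finset.sum_comm]
        simp only [Finset.sum_mul_sum, Fintype.sum_prod_type]
    _ ≤ ∑ i ∈ Finset.range (b.length + 1), coeff i p * coeff (b.length - i) q := by
        refine Finset.sum_le_sum fun i hi => ?_
        have hi' : i ≤ b.length := Finset.mem_range_succ_iff.1 hi
        simpa [hi'] using h _ _ (List.take_append_drop i b)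

theorem sum_ofFn_succ {A : Type*} [AddCommMonoid A] (g : List κ → A) (k : ℕ) :
    ∑ a : Fin (k + 1) → κ, g (List.ofFn a) =
      ∑ x : κ × (Fin k → κ), g (x.1 :: List.ofFn x.2) := by
  rw [← (Fin.consEquiv fun _ : Fin (k + 1) => κ).sum_comp]
  simp [Fin.consEquiv, List.ofFn_succ]

theorem sum_norm_wordProd_le [NormedCommRing R] [NormOneClass R] [DecidableEq ι]
    {v : κ → List ι → R} {p : ℝ⟦X⟧} (hp : ∀ i, 0 ≤ coeff i p)
    (hv : ∀ b, ∑ a, ‖v a b‖ ≤ coeff b.length p) (k : ℕ) (b : List ι) :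
    ∑ a : Fin k → κ, ‖wordProd v (List.ofFn a) b‖ ≤ coeff b.length (p ^ k) := by
  induction k generalizing b with
  | zero => cases b <;> simp [wordProd_nil_apply, coeff_one]
  | succ k ih =>
    rw [sum_ofFn_succ fun l => ‖wordProd v l b‖, pow_succ']
    exact sum_norm_wordConv_le (f := v) (g := fun a => wordProd v (List.ofFn a)) fun c d _ =>
      mul_le_mul (hv c) (ih d) (Finset.sum_nonneg fun _ _ => norm_nonneg _) (hp _)

variable {K : Type*} [NormedField K] [Fintype ι] [DecidableEq ι] {lam : ι → K}
  {F : Matrix ι (ι × ι) K} {f δ : ℝ}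

theorem sum_norm_linearizingSeries_le_of_two_le (hδ : 0 < δ) (hF : ∀ c, ∑ a, ‖F a c‖ ≤ f)
    (hlam : ∀ a (b : List ι), 2 ≤ b.length → δ ≤ ‖wordWeight lam b - lam a‖)
    {b : List ι} (hb : 2 ≤ b.length) :
    ∑ a, ‖linearizingSeries lam F a b‖ ≤
      f / δ * ∑ c : ι × ι,
        ‖wordConv (linearizingSeries lam F c.1) (linearizingSeries lam F c.2) b‖ := by
  set w : ι × ι → K :=
    fun c => wordConv (linearizingSeries lam F c.1) (linearizingSeries lam F c.2) b
  calc ∑ a, ‖linearizingSeries lam F a b‖ ≤ ∑ a, (∑ c, ‖F a c‖ * ‖w c‖) / δ := by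
        refine Finset.sum_le_sum fun a _ => ?_
        rw [linearizingSeries_of_two_le lam F a hb, norm_div]
        refine div_le_div₀ (by positivity) ?_ hδ (hlam a b hb)
        exact norm_sum_le_of_le _ fun c _ => norm_mul_le _ _
    _ = (∑ c, (∑ a, ‖F a c‖) * ‖w c‖) / δ := by
        rw [← Finset.sum_div, Finset.sum_comm]
        simp only [Finset.sum_mul]
    _ ≤ (∑ c, f * ‖w c‖) / δ := by
        gcongr with c
        exact hF c
    _ = f / δ * ∑ c, ‖w c‖ := by rw [← Finset.mul_sum, div_mul_eq_mul_div]

theorem sum_norm_linearizingSeries_le (hf : 0 ≤ f) (hδ : 0 < δ) (hF : ∀ c, ∑ a, ‖F a c‖ ≤ f)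
    (hlam : ∀ a (b : List ι), 2 ≤ b.length → δ ≤ ‖wordWeight lam b - lam a‖) (b : List ι) :
    ∑ a, ‖linearizingSeries lam F a b‖ ≤ coeff b.length (catalanMajorant (f / δ)) := by
  have hr : 0 ≤ f / δ := by positivity
  induction hn : b.length using Nat.strong_induction_on generalizing b with
  | _ n ih =>
  subst hn
  rcases le_or_gt 2 b.length with hb | hb
  · refine (sum_norm_linearizingSeries_le_of_two_le hδ hF hlam hb).trans ?_
    rw [coeff_catalanMajorant_of_two_le _ hb]
    refine mul_le_mul_of_nonneg_left (sum_norm_wordConv_le fun c d hcd => ?_) hr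
    have hlen : c.length + d.length = b.length := by rw [← hcd, List.length_append]
    rcases List.eq_nil_or_concat c with rfl | ⟨_, _, rfl⟩
    · simp
    rcases List.eq_nil_or_concat d with rfl | ⟨_, _, rfl⟩
    · simp
    simp only [List.concat_eq_append, List.length_append, List.length_singleton] at hlen
    exact mul_le_mul (ih _ (by simp; lia) _ rfl) (ih _ (by simp; lia) _ rfl)
      (Finset.sum_nonneg fun _ _ => norm_nonneg _) (coeff_catalanMajorant_nonneg hr _)
  · match b, hb with
    | [], _ => simp
    | [x], _ => simp [linearizingSeries_singleton, apply_ite norm]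

end Majorant

section KroneckerPowers

variable {R : Type*} [CommRing R] {n : ℕ}

/-- Splitting off the first letter of a tuple: the index form of `V ^ ⊗ (k + 1) = V ⊗ V ^ ⊗ k`. -/
def unconsEquiv (n k : ℕ) : (Fin (k + 1) → Fin n) ≃ Fin n × (Fin k → Fin n) :=
  (Fin.consEquiv fun _ => Fin n).symm

/-- Splitting off the first two letters of a tuple: the index form of
`V ^ ⊗ (k + 2) = (V ⊗ V) ⊗ V ^ ⊗ k`. -/
def unconsTwoEquiv (n k : ℕ) : (Fin (k + 2) → Fin n) ≃ (Fin n × Fin n) × (Fin k → Fin n) :=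
  (unconsEquiv n (k + 1)).trans
    (((Equiv.refl (Fin n)).prodCongr (unconsEquiv n k)).trans (Equiv.prodAssoc _ _ _).symm)

@[simp] theorem unconsEquiv_apply {k : ℕ} (a : Fin (k + 1) → Fin n) :
    unconsEquiv n k a = (a 0, fun i => a i.succ) := rfl

@[simp] theorem unconsTwoEquiv_apply {k : ℕ} (a : Fin (k + 2) → Fin n) :
    unconsTwoEquiv n k a = ((a 0, a 1), fun i => a i.succ.succ) := rfl

theorem ofFn_unconsEquiv_symm {k : ℕ} (x : Fin n × (Fin k → Fin n)) :
    List.ofFn ((unconsEquiv n k).symm x) = x.1 :: List.ofFn x.2 := by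
  simp [unconsEquiv, Fin.consEquiv, List.ofFn_succ]

theorem ofFn_unconsTwoEquiv_symm {k : ℕ} (x : (Fin n × Fin n) × (Fin k → Fin n)) :
    List.ofFn ((unconsTwoEquiv n k).symm x) = x.1.1 :: x.1.2 :: List.ofFn x.2 := by
  change List.ofFn ((unconsEquiv n (k + 1)).symm (x.1.1, (unconsEquiv n k).symm (x.1.2, x.2))) = _
  rw [ofFn_unconsEquiv_symm, ofFn_unconsEquiv_symm]

theorem kronPow_one (k : ℕ) : kronPow (1 : Matrix (Fin n) (Fin n) R) k = 1 := by
  ext a b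
  simp only [kronPow, Matrix.of_apply, Matrix.one_apply, Finset.prod_ite_zero,
    Finset.prod_const_one, Finset.mem_univ, true_imp_iff, funext_iff]

theorem kronPow_succ (M : Matrix (Fin n) (Fin n) R) (k : ℕ) :
    kronPow M (k + 1) = (M ⊗ₖ kronPow M k).submatrix (unconsEquiv n k) (unconsEquiv n k) := by
  ext a b
  simp [kronPow, Fin.prod_univ_succ]

theorem kronPow_succ_succ (M : Matrix (Fin n) (Fin n) R) (k : ℕ) :
    kronPow M (k + 2) =
      ((M ⊗ₖ M) ⊗ₖ kronPow M k).submatrix (unconsTwoEquiv n k) (unconsTwoEquiv n k) := by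
  ext a b
  simp [kronPow, Fin.prod_univ_succ, mul_assoc]

theorem kronSum_succ (M : Matrix (Fin n) (Fin n) R) (k : ℕ) :
    kronSum M (k + 1) =
      (M ⊗ₖ 1 + 1 ⊗ₖ kronSum M k).submatrix (unconsEquiv n k) (unconsEquiv n k) := by
  ext a b
  simp [← kronPow_one, kronSum, kronPow, Fin.sum_univ_succ, Finset.prod_filter,
    Fin.prod_univ_succ, Finset.mul_sum, mul_assoc]

theorem kronShift_zero (F : Matrix (Fin n) (Fin n × Fin n) R) : kronShift F 0 = 0 := by
  ext a b
  simp [kronShift]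

theorem kronShift_succ (F : Matrix (Fin n) (Fin n × Fin n) R) (k : ℕ) :
    kronShift F (k + 1) =
      (F ⊗ₖ 1).submatrix (unconsEquiv n k) (unconsTwoEquiv n k) +
        (1 ⊗ₖ kronShift F k).submatrix (unconsEquiv n k) (unconsEquiv n (k + 1)) := by
  ext a b
  by_cases h : a 0 = b 0 <;>
    simp [← kronPow_one, kronShift, kronPow, Fin.sum_univ_succ, Finset.prod_filter,
      Fin.prod_univ_succ, mul_assoc, Matrix.one_apply, h]

theorem kronPow_mul (M P : Matrix (Fin n) (Fin n) R) (k : ℕ) :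
    kronPow (M * P) k = kronPow M k * kronPow P k := by
  induction k with
  | zero => ext a b; simp [kronPow, Matrix.mul_apply]
  | succ k ih =>
    rw [kronPow_succ, kronPow_succ, kronPow_succ, Matrix.submatrix_mul_equiv,
      ← Matrix.mul_kronecker_mul, ih]

theorem kronSum_mul_kronPow {M P Q : Matrix (Fin n) (Fin n) R} (h : M * P = P * Q) (k : ℕ) :
    kronSum M k * kronPow P k = kronPow P k * kronSum Q k := by
  induction k with
  | zero => ext a b; simp [kronSum, Matrix.mul_apply]
  | succ k ih =>
    rw [kronSum_succ, kronSum_succ, kronPow_succ, Matrix.submatrix_mul_equiv,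
      Matrix.submatrix_mul_equiv, Matrix.add_mul, Matrix.mul_add]
    simp only [← Matrix.mul_kronecker_mul, ih, h, Matrix.one_mul, Matrix.mul_one]

theorem kronShift_mul_kronPow {F G : Matrix (Fin n) (Fin n × Fin n) R}
    {P : Matrix (Fin n) (Fin n) R} (h : F * (P ⊗ₖ P) = P * G) (k : ℕ) :
    kronShift F k * kronPow P (k + 1) = kronPow P k * kronShift G k := by
  induction k with
  | zero => simp [kronShift_zero]
  | succ k ih =>
    rw [kronShift_succ, kronShift_succ, Matrix.add_mul, Matrix.mul_add]
    congr 1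
    · simp only [kronPow_succ_succ, kronPow_succ P k, Matrix.submatrix_mul_equiv,
        ← Matrix.mul_kronecker_mul, h, Matrix.one_mul, Matrix.mul_one]
    · rw [kronPow_succ P (k + 1), Matrix.submatrix_mul_equiv, ← Matrix.mul_kronecker_mul, ih,
        kronPow_succ P k, Matrix.submatrix_mul_equiv, ← Matrix.mul_kronecker_mul, Matrix.one_mul,
        Matrix.mul_one]

theorem kronSum_diagonal (lam : Fin n → R) (k : ℕ) :
    kronSum (Matrix.diagonal lam) k = Matrix.diagonal fun a => wordWeight lam (List.ofFn a) := by
  induction k with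
  | zero => ext a b; simp [kronSum, Matrix.diagonal_apply]
  | succ k ih =>
    simp only [kronSum_succ, ih, ← Matrix.diagonal_one, Matrix.diagonal_kronecker_diagonal,
      Matrix.diagonal_add, Matrix.submatrix_diagonal_equiv]
    congr 1
    ext a
    simp [List.ofFn_succ]

theorem sum_kronShift_smul {M : Type*} [AddCommMonoid M] [Module R M]
    (F : Matrix (Fin n) (Fin n × Fin n) R) (G : List (Fin n) → M) (k : ℕ) (a : Fin k → Fin n) :
    ∑ c, kronShift F k a c • G (List.ofFn c) = shiftAct F G (List.ofFn a) := by
  induction k generalizing G with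
  | zero => simp [kronShift_zero, shiftAct]
  | succ k ih =>
    simp only [kronShift_succ, Matrix.add_apply, add_smul, Finset.sum_add_distrib]
    rw [List.ofFn_succ, shiftAct, ← ih]
    congr 1
    · rw [← (unconsTwoEquiv n k).symm.sum_comp, Fintype.sum_prod_type]
      simp only [ofFn_unconsTwoEquiv_symm, Matrix.submatrix_apply, Equiv.apply_symm_apply,
        Matrix.kroneckerMap_apply, Matrix.one_apply, unconsEquiv_apply, mul_ite, mul_one, mul_zero,
        ite_smul, zero_smul, Finset.sum_ite_eq, Finset.mem_univ, if_true]
    · rw [← (unconsEquiv n (k + 1)).symm.sum_comp, Fintype.sum_prod_type]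
      simp only [ofFn_unconsEquiv_symm, Matrix.submatrix_apply, Equiv.apply_symm_apply,
        Matrix.kroneckerMap_apply, Matrix.one_apply, unconsEquiv_apply, ite_mul, one_mul, zero_mul,
        ite_smul, zero_smul, Finset.sum_ite_irrel, Finset.sum_const_zero, Finset.sum_ite_eq,
        Finset.mem_univ, if_true]

end KroneckerPowers

section OneNorm

variable {ι κ μ ν : Type*} [Fintype ι] [Fintype κ] [DecidableEq κ] [Fintype μ] [DecidableEq μ]
  [Fintype ν]

theorem oneNorm_nonneg (M : Matrix ι κ ℂ) : 0 ≤ oneNorm M := norm_nonneg _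

theorem oneNorm_le {M : Matrix ι κ ℂ} {c : ℝ} (hc : 0 ≤ c) (h : ∀ j, ∑ i, ‖M i j‖ ≤ c) :
    oneNorm M ≤ c := by
  refine ContinuousLinearMap.opNorm_le_bound _ hc fun x => ?_
  rw [PiLp.norm_eq_of_L1, PiLp.norm_eq_of_L1]
  calc ∑ i, ‖(M.mulVec x.ofLp) i‖ ≤ ∑ i, ∑ j, ‖M i j‖ * ‖x j‖ :=
        Finset.sum_le_sum fun i _ => norm_sum_le_of_le _ fun j _ => norm_mul_le _ _
    _ = ∑ j, (∑ i, ‖M i j‖) * ‖x j‖ := by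
        rw [Finset.sum_comm]
        simp only [Finset.sum_mul]
    _ ≤ ∑ j, c * ‖x j‖ := by
        gcongr with j
        exact h j
    _ = c * ∑ j, ‖x j‖ := by rw [Finset.mul_sum]

theorem sum_norm_le_oneNorm (M : Matrix ι κ ℂ) (j : κ) : ∑ i, ‖M i j‖ ≤ oneNorm M := by
  have h := (Matrix.toLpLin 1 1 M).toContinuousLinearMap.le_opNorm (PiLp.single 1 j (1 : ℂ))
  rw [PiLp.norm_single, norm_one, mul_one, PiLp.norm_eq_of_L1] at h
  simpa [oneNorm, Matrix.toLpLin_apply] using h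

theorem oneNorm_mul_le (A : Matrix ι κ ℂ) (B : Matrix κ μ ℂ) :
    oneNorm (A * B) ≤ oneNorm A * oneNorm B := by
  rw [oneNorm, Matrix.toLpLin_mul 1 1 1]
  exact ContinuousLinearMap.opNorm_comp_le (Matrix.toLpLin 1 1 A).toContinuousLinearMap
    (Matrix.toLpLin 1 1 B).toContinuousLinearMap

theorem oneNorm_kronecker_le (A : Matrix ι κ ℂ) (B : Matrix ν μ ℂ) :
    oneNorm (A ⊗ₖ B) ≤ oneNorm A * oneNorm B := by
  refine oneNorm_le (mul_nonneg (oneNorm_nonneg A) (oneNorm_nonneg B)) fun j => ?_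
  simp only [Matrix.kroneckerMap_apply, norm_mul, Fintype.sum_prod_type]
  rw [← Finset.sum_mul_sum]
  exact mul_le_mul (sum_norm_le_oneNorm A _) (sum_norm_le_oneNorm B _)
    (Finset.sum_nonneg fun _ _ => norm_nonneg _) (oneNorm_nonneg A)

theorem oneNorm_kronPow_le {n : ℕ} (P : Matrix (Fin n) (Fin n) ℂ) (k : ℕ) :
    oneNorm (kronPow P k) ≤ oneNorm P ^ k := by
  refine oneNorm_le (pow_nonneg (oneNorm_nonneg P) k) fun b => ?_
  simp only [kronPow, Matrix.of_apply, norm_prod]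
  rw [← Fintype.prod_sum fun l i => ‖P i (b l)‖]
  calc ∏ l, ∑ i, ‖P i (b l)‖ ≤ ∏ _l : Fin k, oneNorm P :=
        Finset.prod_le_prod (fun _ _ => Finset.sum_nonneg fun _ _ => norm_nonneg _)
          fun l _ => sum_norm_le_oneNorm P (b l)
    _ = oneNorm P ^ k := Fin.prod_const k _

end OneNorm

section NormalizeColumns

variable {n : ℕ} {W : Matrix (Fin n) (Fin n) ℂ}

theorem sum_norm_col_pos (hW : IsUnit W.det) (j : Fin n) : 0 < ∑ l, ‖W l j‖ := by
  by_contra! h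
  have hcol := (Finset.sum_eq_zero_iff_of_nonneg fun _ _ => norm_nonneg _).1
    (h.antisymm (Finset.sum_nonneg fun l _ => norm_nonneg (W l j)))
  exact hW.ne_zero (Matrix.det_eq_zero_of_column_eq_zero j fun i => by
    simpa using hcol i (Finset.mem_univ i))

theorem normalizeColumns_eq (W : Matrix (Fin n) (Fin n) ℂ) :
    normalizeColumns W = W * Matrix.diagonal fun j => (((∑ l, ‖W l j‖ : ℝ) : ℂ))⁻¹ := by
  ext i j
  rw [Matrix.mul_diagonal, ← div_eq_mul_inv, normalizeColumns, Matrix.of_apply]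

theorem inv_normalizeColumns_mul (hW : IsUnit W.det) :
    (Matrix.diagonal (fun j => ((∑ l, ‖W l j‖ : ℝ) : ℂ)) * W⁻¹) * normalizeColumns W = 1 := by
  rw [normalizeColumns_eq, Matrix.mul_assoc, Matrix.nonsing_inv_mul_cancel_left _ _ hW,
    Matrix.diagonal_mul_diagonal, ← Matrix.diagonal_one]
  congr 1
  ext j
  exact mul_inv_cancel₀ (Complex.ofReal_ne_zero.2 (sum_norm_col_pos hW j).ne')

theorem isUnit_det_normalizeColumns (hW : IsUnit W.det) : IsUnit (normalizeColumns W).det :=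
  Matrix.isUnit_det_of_left_inverse (inv_normalizeColumns_mul hW)

theorem mul_normalizeColumns (hW : IsUnit W.det) (lam : Fin n → ℂ) :
    W * Matrix.diagonal lam * W⁻¹ * normalizeColumns W =
      normalizeColumns W * Matrix.diagonal lam := by
  rw [normalizeColumns_eq, Matrix.mul_assoc, Matrix.nonsing_inv_mul_cancel_left _ _ hW,
    Matrix.mul_assoc, Matrix.mul_assoc, Matrix.diagonal_mul_diagonal,
    Matrix.diagonal_mul_diagonal]
  simp only [mul_comm]

theorem oneNorm_normalizeColumns_le (hW : IsUnit W.det) : oneNorm (normalizeColumns W) ≤ 1 := by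
  refine oneNorm_le zero_le_one fun j => ?_
  have h := sum_norm_col_pos hW j
  simp only [normalizeColumns, Matrix.of_apply, norm_div, Complex.norm_real, Real.norm_eq_abs,
    abs_of_pos h]
  rw [← Finset.sum_div, div_self h.ne']

theorem oneNorm_diagonal_sum_norm_le (W : Matrix (Fin n) (Fin n) ℂ) :
    oneNorm (Matrix.diagonal fun j => ((∑ l, ‖W l j‖ : ℝ) : ℂ)) ≤ oneNorm W := by
  refine oneNorm_le (oneNorm_nonneg W) fun j => ?_
  have hj : 0 ≤ ∑ l, ‖W l j‖ := Finset.sum_nonneg fun _ _ => norm_nonneg _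
  rw [Finset.sum_eq_single j (fun i _ hi => by rw [Matrix.diagonal_apply_ne _ hi, norm_zero])
    (by simp), Matrix.diagonal_apply_eq, Complex.norm_of_nonneg hj]
  exact sum_norm_le_oneNorm W j

theorem oneNorm_inv_normalizeColumns_le (hW : IsUnit W.det) :
    oneNorm (normalizeColumns W)⁻¹ ≤ cond W := by
  rw [Matrix.inv_eq_left_inv (inv_normalizeColumns_mul hW)]
  exact (oneNorm_mul_le _ _).trans
    (mul_le_mul_of_nonneg_right (oneNorm_diagonal_sum_norm_le W) (oneNorm_nonneg _))

theorem oneNorm_inv_mul_mul_kronecker_le (hW : IsUnit W.det)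
    (F : Matrix (Fin n) (Fin n × Fin n) ℂ) :
    oneNorm ((normalizeColumns W)⁻¹ * F * (normalizeColumns W ⊗ₖ normalizeColumns W)) ≤
      cond W * oneNorm F := by
  set P := normalizeColumns W
  have hP : oneNorm P ≤ 1 := oneNorm_normalizeColumns_le hW
  calc oneNorm (P⁻¹ * F * (P ⊗ₖ P)) ≤ oneNorm (P⁻¹ * F) * oneNorm (P ⊗ₖ P) := oneNorm_mul_le _ _
    _ ≤ oneNorm (P⁻¹ * F) := mul_le_of_le_one_right (oneNorm_nonneg _) <|
      (oneNorm_kronecker_le P P).trans (mul_le_one₀ hP (oneNorm_nonneg P) hP)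
    _ ≤ oneNorm P⁻¹ * oneNorm F := oneNorm_mul_le _ _
    _ ≤ cond W * oneNorm F :=
      mul_le_mul_of_nonneg_right (oneNorm_inv_normalizeColumns_le hW) (oneNorm_nonneg _)

end NormalizeColumns

section Blocks

variable {R : Type*} {n N : ℕ}

theorem ext_block {A B : Matrix (Index n N) (Index n N) R}
    (h : ∀ k j, block A k j = block B k j) : A = B := by
  ext ⟨k, a⟩ ⟨j, b⟩
  exact congr_fun₂ (h k j) a b

variable [CommRing R]

theorem block_mul (A B : Matrix (Index n N) (Index n N) R) (k j : Fin N) :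
    block (A * B) k j = ∑ i, block A k i * block B i j := by
  ext a b
  simp only [block, Matrix.of_apply, Matrix.mul_apply, Matrix.sum_apply, Fintype.sum_sigma]

section BlockDiagonal

variable (d : ∀ k : Fin N, Matrix (Fin (k.val + 1) → Fin n) (Fin (k.val + 1) → Fin n) R)

theorem block_blockDiagonal'_self (k : Fin N) : block (Matrix.blockDiagonal' d) k k = d k := by
  ext a b
  exact Matrix.blockDiagonal'_apply_eq d k a b

theorem block_blockDiagonal'_of_ne {k j : Fin N} (h : k ≠ j) :
    block (Matrix.blockDiagonal' d) k j = 0 := by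
  ext a b
  exact Matrix.blockDiagonal'_apply_ne d a b h

theorem block_blockDiagonal'_mul (B : Matrix (Index n N) (Index n N) R) (k j : Fin N) :
    block (Matrix.blockDiagonal' d * B) k j = d k * block B k j := by
  rw [block_mul, Finset.sum_eq_single k, block_blockDiagonal'_self]
  · intro i _ hi
    rw [block_blockDiagonal'_of_ne d hi.symm, Matrix.zero_mul]
  · simp

theorem block_mul_blockDiagonal' (B : Matrix (Index n N) (Index n N) R) (k j : Fin N) :
    block (B * Matrix.blockDiagonal' d) k j = block B k j * d j := by
  rw [block_mul, Finset.sum_eq_single j, block_blockDiagonal'_self]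
  · intro i _ hi
    rw [block_blockDiagonal'_of_ne d hi, Matrix.mul_zero]
  · simp

end BlockDiagonal

section CarlemanBlocks

variable (F₁ : Matrix (Fin n) (Fin n) R) (F₂ : Matrix (Fin n) (Fin n × Fin n) R)

theorem block_carleman_self (k : Fin N) :
    block (carleman F₁ F₂ N) k k = kronSum F₁ (k.val + 1) := by
  ext a b
  simp [block, carleman]

theorem block_carleman_succ (k : Fin N) (h : k.val + 1 < N) :
    block (carleman F₁ F₂ N) k ⟨k.val + 1, h⟩ = kronShift F₂ (k.val + 1) := by
  ext a b
  simp [block, carleman]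

theorem block_carleman_of_ne {k j : Fin N} (h : j ≠ k) (h' : j.val ≠ k.val + 1) :
    block (carleman F₁ F₂ N) k j = 0 := by
  ext a b
  simp [block, carleman, Fin.val_ne_of_ne h.symm, h'.symm]

theorem block_carleman_mul_of_lt (B : Matrix (Index n N) (Index n N) R) (k j : Fin N)
    (h : k.val + 1 < N) :
    block (carleman F₁ F₂ N * B) k j =
      kronSum F₁ (k.val + 1) * block B k j +
        kronShift F₂ (k.val + 1) * block B ⟨k.val + 1, h⟩ j := by
  rw [block_mul, Fintype.sum_eq_add k ⟨k.val + 1, h⟩ (by simp [Fin.ext_iff]),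
    block_carleman_self, block_carleman_succ]
  rintro i ⟨hi, hi'⟩
  rw [block_carleman_of_ne F₁ F₂ hi fun e => hi' (Fin.ext e), Matrix.zero_mul]

theorem block_carleman_mul_of_eq (B : Matrix (Index n N) (Index n N) R) (k j : Fin N)
    (h : k.val + 1 = N) :
    block (carleman F₁ F₂ N * B) k j = kronSum F₁ (k.val + 1) * block B k j := by
  rw [block_mul, Fintype.sum_eq_single k, block_carleman_self]
  intro i hi
  rw [block_carleman_of_ne F₁ F₂ hi (i.2.trans_eq h.symm).ne, Matrix.zero_mul]

end CarlemanBlocks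

theorem block_blockPow_mul (P : Matrix (Fin n) (Fin n) R) (B : Matrix (Index n N) (Index n N) R)
    (k j : Fin N) : block (blockPow P N * B) k j = kronPow P (k.val + 1) * block B k j :=
  block_blockDiagonal'_mul _ B k j

theorem carleman_mul_blockPow {F₁ G₁ P : Matrix (Fin n) (Fin n) R}
    {F₂ G₂ : Matrix (Fin n) (Fin n × Fin n) R} (h₁ : F₁ * P = P * G₁)
    (h₂ : F₂ * (P ⊗ₖ P) = P * G₂) :
    carleman F₁ F₂ N * blockPow P N = blockPow P N * carleman G₁ G₂ N := by
  refine ext_block fun k j => ?_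
  rw [block_blockPow_mul, blockPow, block_mul_blockDiagonal']
  by_cases h : j = k
  · subst h
    rw [block_carleman_self, block_carleman_self, kronSum_mul_kronPow h₁]
  by_cases h' : j.val = k.val + 1
  · obtain ⟨j, hj⟩ := j
    obtain rfl : j = k.val + 1 := h'
    rw [block_carleman_succ, block_carleman_succ, kronShift_mul_kronPow h₂]
  · rw [block_carleman_of_ne _ _ h h', block_carleman_of_ne _ _ h h', Matrix.zero_mul,
      Matrix.mul_zero]

theorem isUnit_det_blockPow {P : Matrix (Fin n) (Fin n) R} (hP : IsUnit P.det) :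
    IsUnit (blockPow P N).det := by
  refine Matrix.isUnit_det_of_left_inverse (B := blockPow P⁻¹ N) ?_
  rw [blockPow, blockPow, ← Matrix.blockDiagonal'_mul]
  simp only [← kronPow_mul, Matrix.nonsing_inv_mul _ hP, kronPow_one]
  exact Matrix.blockDiagonal'_one

theorem det_eq_one_of_block {V : Matrix (Index n N) (Index n N) R}
    (hlow : ∀ k j : Fin N, j < k → block V k j = 0) (hdiag : ∀ k : Fin N, block V k k = 1) :
    V.det = 1 := by
  have hV : V.BlockTriangular Sigma.fst := by
    rintro ⟨k, a⟩ ⟨j, b⟩ h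
    exact congr_fun₂ (hlow k j h) a b
  rw [hV.det_fintype]
  refine Finset.prod_eq_one fun k _ => ?_
  have hk : V.toSquareBlock Sigma.fst k = 1 := by
    ext ⟨⟨i, a⟩, hi⟩ ⟨⟨j, b⟩, hj⟩
    obtain rfl : i = k := hi
    obtain rfl : j = i := hj
    simpa [Matrix.toSquareBlock_def, block, Matrix.one_apply] using congr_fun₂ (hdiag j) a b
  rw [hk, Matrix.det_one]

theorem eigenvalueMatrix_isDiag (lam : Fin n → R) : (eigenvalueMatrix lam N).IsDiag := by
  simp only [eigenvalueMatrix, kronSum_diagonal, Matrix.blockDiagonal'_diagonal]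
  exact Matrix.isDiag_diagonal _

end Blocks

section Eigenvectors

variable {K : Type*} [Field K] {n : ℕ} (lam : Fin n → K) (F : Matrix (Fin n) (Fin n × Fin n) K)

/-- The matrix that expresses the `k`-fold tensor power of `x = u(y)` in the components of order `j`
of the tensor powers of `y`, where `u` is given by `linearizingSeries lam F`. -/
def eigenvectorBlock (k j : ℕ) : Matrix (Fin k → Fin n) (Fin j → Fin n) K :=
  Matrix.of fun a b => wordProd (linearizingSeries lam F) (List.ofFn a) (List.ofFn b)

theorem eigenvectorBlock_of_lt {k j : ℕ} (h : j < k) : eigenvectorBlock lam F k j = 0 := by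
  ext a b
  exact wordProd_of_length_lt (linearizingSeries_nil lam F) (by simpa using h)

theorem eigenvectorBlock_self (k : ℕ) : eigenvectorBlock lam F k k = 1 := by
  ext a b
  rw [eigenvectorBlock, Matrix.of_apply, Matrix.one_apply, wordProd_of_length_eq
    (linearizingSeries_nil lam F) (linearizingSeries_singleton lam F) (by simp)]
  simp only [List.ofFn_injective.eq_iff]

variable {lam} in
theorem kronSum_mul_eigenvectorBlock
    (hlam : ∀ a (b : List (Fin n)), 2 ≤ b.length → wordWeight lam b ≠ lam a) (k j : ℕ) :
    kronSum (Matrix.diagonal lam) k * eigenvectorBlock lam F k j +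
        kronShift F k * eigenvectorBlock lam F (k + 1) j =
      eigenvectorBlock lam F k j * kronSum (Matrix.diagonal lam) j := by
  ext a b
  have h := congr_fun (wordWeight_mul_wordProd (wordWeight_mul_linearizingSeries F hlam)
    (List.ofFn a)) (List.ofFn b)
  rw [← sum_kronShift_smul] at h
  simp only [Pi.add_apply, Pi.mul_apply, Pi.smul_apply, Finset.sum_apply, smul_eq_mul] at h
  rw [kronSum_diagonal, kronSum_diagonal, Matrix.add_apply, Matrix.diagonal_mul,
    Matrix.mul_diagonal, Matrix.mul_apply, mul_comm _ (wordWeight lam _)]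
  exact h.symm

/-- The matrix of eigenvectors of the truncated Carleman matrix of `x' = diag lam x + F (x ⊗ x)`. -/
def eigenvectors (N : ℕ) : Matrix (Index n N) (Index n N) K :=
  Matrix.of fun p q => eigenvectorBlock lam F (p.1.val + 1) (q.1.val + 1) p.2 q.2

variable {N : ℕ}

theorem block_eigenvectors (k j : Fin N) :
    block (eigenvectors lam F N) k j = eigenvectorBlock lam F (k.val + 1) (j.val + 1) := rfl

theorem block_eigenvectors_of_lt {k j : Fin N} (h : j < k) :
    block (eigenvectors lam F N) k j = 0 := by
  rw [block_eigenvectors, eigenvectorBlock_of_lt lam F (Nat.succ_lt_succ h)]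

theorem block_eigenvectors_self (k : Fin N) : block (eigenvectors lam F N) k k = 1 := by
  rw [block_eigenvectors, eigenvectorBlock_self]

theorem det_eigenvectors : (eigenvectors lam F N).det = 1 :=
  det_eq_one_of_block (fun _ _ => block_eigenvectors_of_lt lam F) (block_eigenvectors_self lam F)

variable {lam} in
theorem carleman_mul_eigenvectors
    (hlam : ∀ a (b : List (Fin n)), 2 ≤ b.length → wordWeight lam b ≠ lam a) :
    carleman (Matrix.diagonal lam) F N * eigenvectors lam F N =
      eigenvectors lam F N * eigenvalueMatrix lam N := by
  refine ext_block fun k j => ?_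
  rw [eigenvalueMatrix, block_mul_blockDiagonal', block_eigenvectors,
    ← kronSum_mul_eigenvectorBlock F hlam]
  rcases (Nat.succ_le_of_lt k.2).lt_or_eq with hk | hk
  · rw [block_carleman_mul_of_lt _ _ _ _ _ hk, block_eigenvectors, block_eigenvectors]
  · rw [block_carleman_mul_of_eq _ _ _ _ _ hk, block_eigenvectors,
      eigenvectorBlock_of_lt lam F (show j.val + 1 < k.val + 1 + 1 by lia), Matrix.mul_zero,
      add_zero]

end Eigenvectors

section Bounds

variable {n N : ℕ} {lam : Fin n → ℂ}

theorem sum_count_eq_length (b : List (Fin n)) : ∑ j, b.count j = b.length := by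
  simpa using Multiset.sum_count_eq_card (s := Finset.univ) (m := (b : Multiset (Fin n)))
    fun a _ => Finset.mem_univ a

theorem NoResonance.wordWeight_ne (hres : NoResonance lam) (a : Fin n) (b : List (Fin n))
    (hb : 2 ≤ b.length) : wordWeight lam b ≠ lam a := by
  rw [wordWeight_eq_sum_count]
  exact (hres a _ (by rwa [sum_count_eq_length])).symm

theorem resonanceParam_le (a : Fin n) (b : List (Fin n)) (hb : 2 ≤ b.length) :
    resonanceParam lam ≤ ‖wordWeight lam b - lam a‖ := by
  have hbdd : BddBelow (Set.range fun m : {m : Fin n → ℕ // 2 ≤ ∑ j, m j} =>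
      ‖lam a - ∑ j, (m.1 j : ℂ) * lam j‖) :=
    ⟨0, Set.forall_mem_range.2 fun _ => norm_nonneg _⟩
  rw [wordWeight_eq_sum_count, norm_sub_rev]
  refine (ciInf_le ⟨0, Set.forall_mem_range.2 fun _ => ?_⟩ a).trans
    (ciInf_le hbdd ⟨fun j => b.count j, by rwa [sum_count_eq_length]⟩)
  exact Real.iInf_nonneg fun _ => norm_nonneg _

theorem oneNorm_eigenvectorBlock_le {F : Matrix (Fin n) (Fin n × Fin n) ℂ} {f : ℝ}
    (hΔ : 0 < resonanceParam lam) (hf : oneNorm F ≤ f) {k j : ℕ} (hkj : k ≤ j) :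
    oneNorm (eigenvectorBlock lam F k j) ≤
      (f / resonanceParam lam) ^ (j - k) * ballot k (j - k) := by
  obtain ⟨m, rfl⟩ := Nat.exists_eq_add_of_le hkj
  rw [Nat.add_sub_cancel_left]
  have hf₀ : 0 ≤ f := (oneNorm_nonneg F).trans hf
  have hx : 0 ≤ f / resonanceParam lam := by positivity
  have hseries := sum_norm_linearizingSeries_le hf₀ hΔ
    (fun c => (sum_norm_le_oneNorm F c).trans hf) resonanceParam_le
  refine oneNorm_le (by positivity) fun b => ?_
  have hprod := sum_norm_wordProd_le (coeff_catalanMajorant_nonneg hx) hseries k (List.ofFn b)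
  rwa [List.length_ofFn, coeff_add_catalanMajorant_pow] at hprod

theorem oneNorm_block_blockPow_mul_le {P : Matrix (Fin n) (Fin n) ℂ} (hP : oneNorm P ≤ 1)
    (B : Matrix (Index n N) (Index n N) ℂ) (k j : Fin N) :
    oneNorm (block (blockPow P N * B) k j) ≤ oneNorm (block B k j) := by
  rw [block_blockPow_mul]
  exact (oneNorm_mul_le _ _).trans <| mul_le_of_le_one_left (oneNorm_nonneg _) <|
    (oneNorm_kronPow_le P _).trans (pow_le_one₀ (oneNorm_nonneg P) hP)

theorem ballot_sub_le_choose {k j : ℕ} (hkj : k ≤ j) :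
    ballot k (j - k) ≤ (2 * j - k).choose (j - k) := by
  have h := ballot_le_choose k (j - k)
  rwa [show 2 * (j - k) + k = 2 * j - k by lia] at h

theorem ballot_sub_le_exp_mul_div_pow {k j : ℕ} (hkj : k < j) :
    (ballot k (j - k) : ℝ) ≤ (Real.exp 1 * ((2 * j - k : ℝ) / (j - k : ℝ))) ^ (j - k) := by
  have h := choose_le_exp_mul_div_pow (2 * j - k) (Nat.sub_ne_zero_of_lt hkj)
  rw [Nat.cast_sub (by lia), Nat.cast_sub hkj.le, Nat.cast_mul, Nat.cast_ofNat] at h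
  exact (mod_cast ballot_sub_le_choose hkj.le : (ballot k (j - k) : ℝ) ≤ _).trans h

theorem pow_mul_le_mul_pow {x y c : ℝ} {m : ℕ} (hx : 0 ≤ x) (hc : c ≤ y ^ m) :
    x ^ m * c ≤ (y * x) ^ m := by
  rw [mul_pow, mul_comm]
  exact mul_le_mul_of_nonneg_right hc (pow_nonneg hx m)

theorem bounds_of_le_pow_mul_ballot {k j : ℕ} {x c : ℝ} (hx : 0 ≤ x)
    (h : k ≤ j → c ≤ x ^ (j - k) * ballot (k + 1) (j - k)) :
    (k ≤ j → c ≤ x ^ (j - k) * ((2 * (j + 1) - (k + 1)).choose (j - k) : ℝ)) ∧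
    (k < j → c ≤ (Real.exp 1 * ((2 * (j + 1) - (k + 1) : ℝ) / (j - k : ℝ)) * x) ^ (j - k)) ∧
    (k ≤ j → k + 1 ≤ 5 → c ≤ (2 * Real.exp 1 * x) ^ (j - k)) := by
  refine ⟨fun hkj => (h hkj).trans ?_, fun hkj => (h hkj.le).trans ?_,
    fun hkj hk => (h hkj).trans (pow_mul_le_mul_pow hx (ballot_le_two_mul_exp_pow hk _))⟩
  · refine mul_le_mul_of_nonneg_left (Nat.cast_le.2 ?_) (pow_nonneg hx _)
    simpa only [Nat.add_sub_add_right] using ballot_sub_le_choose (Nat.add_le_add_right hkj 1)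
  · refine pow_mul_le_mul_pow hx ?_
    simpa only [Nat.add_sub_add_right, Nat.cast_add_one, add_sub_add_right_eq_sub] using
      ballot_sub_le_exp_mul_div_pow (Nat.add_lt_add_right hkj 1)

theorem bounds_of_le_oneNorm_block_eigenvectors {F : Matrix (Fin n) (Fin n × Fin n) ℂ}
    {κ f c : ℝ} (hΔ : 0 < resonanceParam lam) (hF : oneNorm F ≤ κ * f) {k j : Fin N}
    (hc : c ≤ oneNorm (block (eigenvectors lam F N) k j)) :
    (k ≤ j → c ≤ (κ * f / resonanceParam lam) ^ (j.val - k.val) *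
      (Nat.choose (2 * (j.val + 1) - (k.val + 1)) (j.val - k.val) : ℝ)) ∧
    (k < j → c ≤ (Real.exp 1 * ((2 * (j.val + 1) - (k.val + 1) : ℝ) / (j.val - k.val : ℝ)) *
      κ * f / resonanceParam lam) ^ (j.val - k.val)) ∧
    (k ≤ j → k.val + 1 ≤ 5 →
      c ≤ (2 * Real.exp 1 * κ * f / resonanceParam lam) ^ (j.val - k.val)) := by
  have hx : 0 ≤ κ * f / resonanceParam lam := div_nonneg ((oneNorm_nonneg F).trans hF) hΔ.le
  have h := bounds_of_le_pow_mul_ballot hx fun hkj : k.val ≤ j.val => hc.trans <| by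
    simpa only [block_eigenvectors, Nat.add_sub_add_right] using
      oneNorm_eigenvectorBlock_le hΔ hF (Nat.add_le_add_right hkj 1)
  simpa only [mul_div_assoc, mul_assoc, Fin.le_def, Fin.lt_def] using h

end Bounds

end Carleman

theorem mainTheorem2 (n N : ℕ)
    (F₁ : Matrix (Fin n) (Fin n) ℂ) (F₂ : Matrix (Fin n) (Fin n × Fin n) ℂ)
    (W : Matrix (Fin n) (Fin n) ℂ) (lam : Fin n → ℂ)
    (hW : IsUnit W.det) (hF₁ : F₁ = W * Matrix.diagonal lam * W⁻¹)
    (hres : Carleman.NoResonance lam) :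
    (Carleman.eigenvalueMatrix lam N).IsDiag ∧
    ∃ V V₀ : Matrix (Carleman.Index n N) (Carleman.Index n N) ℂ,
      -- `V` diagonalizes the Carleman matrix
      IsUnit V.det ∧
      Carleman.carleman F₁ F₂ N * V = V * Carleman.eigenvalueMatrix lam N ∧
      (∀ k j : Fin N, j < k → Carleman.block V k j = 0) ∧
      (∀ k : Fin N, Carleman.block V k k =
        Carleman.kronPow (Carleman.normalizeColumns W) (k.val + 1)) ∧
      -- `V₀` is `V` in the eigenbasis of `F₁`, where the diagonal blocks are identities
      V = Carleman.blockPow (Carleman.normalizeColumns W) N * V₀ ∧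
      Carleman.carleman (Matrix.diagonal lam)
          ((Carleman.normalizeColumns W)⁻¹ * F₂ *
            (Carleman.normalizeColumns W ⊗ₖ Carleman.normalizeColumns W)) N * V₀ =
        V₀ * Carleman.eigenvalueMatrix lam N ∧
      (∀ k j : Fin N, j < k → Carleman.block V₀ k j = 0) ∧
      (∀ k : Fin N, Carleman.block V₀ k k = 1) ∧
      -- the bounds on the blocks, the same for `V` and for `V₀`
      (0 < Carleman.resonanceParam lam → ∀ M : Matrix (Carleman.Index n N) (Carleman.Index n N) ℂ,
        M = V ∨ M = V₀ → ∀ k j : Fin N,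
        (k ≤ j → Carleman.oneNorm (Carleman.block M k j) ≤
          (Carleman.cond W * Carleman.oneNorm F₂ / Carleman.resonanceParam lam) ^
              (j.val - k.val) *
            (Nat.choose (2 * (j.val + 1) - (k.val + 1)) (j.val - k.val) : ℝ)) ∧
        (k < j → Carleman.oneNorm (Carleman.block M k j) ≤
          (Real.exp 1 * ((2 * (j.val + 1) - (k.val + 1) : ℝ) / (j.val - k.val : ℝ)) *
              Carleman.cond W * Carleman.oneNorm F₂ / Carleman.resonanceParam lam) ^
            (j.val - k.val)) ∧
        (k ≤ j → k.val + 1 ≤ 5 → Carleman.oneNorm (Carleman.block M k j) ≤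
          (2 * Real.exp 1 * Carleman.cond W * Carleman.oneNorm F₂ /
            Carleman.resonanceParam lam) ^ (j.val - k.val))) := by
  set P := Carleman.normalizeColumns W
  set G := P⁻¹ * F₂ * (P ⊗ₖ P) with hG
  have hP : IsUnit P.det := Carleman.isUnit_det_normalizeColumns hW
  have h₁ : F₁ * P = P * Matrix.diagonal lam := hF₁ ▸ Carleman.mul_normalizeColumns hW lam
  have h₂ : F₂ * (P ⊗ₖ P) = P * G := by
    rw [hG, Matrix.mul_assoc, Matrix.mul_nonsing_inv_cancel_left _ _ hP]
  have hV₀ := Carleman.carleman_mul_eigenvectors G (N := N) hres.wordWeight_ne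
  refine ⟨Carleman.eigenvalueMatrix_isDiag lam,
    Carleman.blockPow P N * Carleman.eigenvectors lam G N, Carleman.eigenvectors lam G N,
    ?_, ?_, fun k j h => ?_, fun k => ?_, rfl, hV₀,
    fun k j h => Carleman.block_eigenvectors_of_lt lam G h,
    Carleman.block_eigenvectors_self lam G, fun hΔ M hM k j =>
    Carleman.bounds_of_le_oneNorm_block_eigenvectors hΔ
      (Carleman.oneNorm_inv_mul_mul_kronecker_le hW F₂) ?_⟩
  · rw [Matrix.det_mul, Carleman.det_eigenvectors, mul_one]
    exact Carleman.isUnit_det_blockPow hP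
  · rw [← Matrix.mul_assoc, Carleman.carleman_mul_blockPow h₁ h₂, Matrix.mul_assoc, hV₀,
      Matrix.mul_assoc]
  · rw [Carleman.block_blockPow_mul, Carleman.block_eigenvectors_of_lt lam G h, Matrix.mul_zero]
  · rw [Carleman.block_blockPow_mul, Carleman.block_eigenvectors_self, Matrix.mul_one]
  · rcases hM with rfl | rfl
    exacts [Carleman.oneNorm_block_blockPow_mul_le (Carleman.oneNorm_normalizeColumns_le hW) _ k j,
      le_rfl]
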